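/- Theorem 8.7. A *quantale* here is a complete lattice $A$ with least element $0$, greatest element $1$ and a commutative associative multiplication with unit $1$ that distributes over arbitrary joins. $K(A)$ is the set of compact elements, and $A$ is *coherent* if every element is a join of compact elements, $1\in K(A)$, and $K(A)$ is closed under multiplication. For $a\in A$ put $a^{\perp}=\bigvee\{x\in A : ax=0\}$; $a$ is *pure* if $a\vee c^{\perp}=1$ for all $c\in K(A)$ with $c\le a$. The pure elements form a frame $Vir(A)$, with joins and finite meets as in $A$. $A$ is a *$PF$-quantale* if $c^{\perp}$ is pure for every $c\in K(A)$, and a *$PP$-quantale* if $c^{\perp}$ has a complement in $A$ for every $c\in K(A)$. An element $p<1$ is *$m$-prime* if $ab\le p$ implies $a\le p$ or $b\le p$. $Spec_Z(A)$ is the set of $m$-prime elements with the topology whose open sets are $D(a)=\{p : a\not\le p\}$, $a\in A$, and $Min_Z(A)$ is its subspace of minimal $m$-prime elements, with underlying set $Min(A)$. $Spec_Z(Vir(A))$ is defined in the same way for the frame $Vir(A)$, with the meet as multiplication. The *reticulation* of a coherent quantale $A$ is the bounded distributive lattice $L(A)$, unique up to isomorphism, with a surjection $\lambda:K(A)\to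 L(A)$ such that, for all $c,d\in K(A)$, $\lambda(c\vee d)\le\lambda(c)\vee\lambda(d)$, $\lambda(cd)=\lambda(c)\wedge\lambda(d)$, and $\lambda(c)\le\lambda(d)$ iff $c^n\le d$ for some integer $n\ge 1$. For a bounded distributive lattice $L$, $Spec_{Id,Z}(L)$ is the set of prime ideals of $L$ with the topology generated by the sets $\{P : x\notin P\}$, $x\in L$, and $Min_{Id,Z}(L)$ is its subspace of minimal prime ideals. $L$ is a *Stone lattice* if for every $x\in L$ there is a complemented $e\in L$ with $\{y\in L : x\wedge y=0\}=\{y\in L : y\le e\}$. Let $A$ be a coherent $PF$-quantale. Then the following are equivalent: 1. $A$ is a $PP$-quantale; 2. the reticulation $L(A)$ is a Stone lattice; 3. the inclusion $Min_{Id,Z}(L(A))\subseteq Spec_{Id,Z}(L(A))$ has a continuous retraction; 4. the inclusion $Min_Z(A)\subseteq Spec_Z(A)$ has a continuous retraction; 5. for every $c\in K(A)$, $Min(A)\cap D(c)$ is (as a set of elements of $A$) an open subset of $Spec_Z(Vir(A))$; 6. $Min_Z(A)$ is a compact space. -/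

import Mathlib

namespace PPQuantale

/-! ### Quantales

A quantale is Mathlib's `IsQuantale`. All quantales are commutative and integral. -/

/-- A commutative integral quantale: the top element is the unit of the multiplication. -/
class IsIntegralQuantale (A : Type*) [CommMonoid A] [CompleteLattice A] : Prop
    extends IsQuantale A where
  one_eq_top : (1 : A) = ⊤

/-- A coherent quantale: every element is a join of compact elements, the top element is
compact, and the compact elements are closed under multiplication. -/
class IsCoherentQuantale (A : Type*) [CommMonoid A] [CompleteLattice A] : Prop
    extends IsIntegralQuantale A, IsCompactlyGenerated A where
  isCompactElement_top : IsCompactElement (⊤ : A)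
  isCompactElement_mul : ∀ c d : A, IsCompactElement c → IsCompactElement d →
    IsCompactElement (c * d)

section Basic

variable {A : Type*} [CommMonoid A] [CompleteLattice A]

theorem mul_le_left_of_integral [IsIntegralQuantale A] (a b : A) : a * b ≤ a := by
  calc a * b ≤ a * 1 := mul_le_mul_right (IsIntegralQuantale.one_eq_top (A := A) ▸ le_top) a
    _ = a := mul_one a

theorem mul_le_right_of_integral [IsIntegralQuantale A] (a b : A) : a * b ≤ b := by
  rw [mul_comm]; exact mul_le_left_of_integral b a

/-- The annihilator `a^⊥`, the join of all `x` with `a * x = 0`. -/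
def perp (a : A) : A := sSup {x | a * x = ⊥}

theorem le_perp_iff [IsQuantale A] {a x : A} : x ≤ perp a ↔ a * x = ⊥ := by
  constructor
  · intro h
    refine le_bot_iff.1 ((mul_le_mul_right h a).trans ?_)
    rw [perp, mul_sSup_distrib]
    exact iSup₂_le fun y hy => le_of_eq hy
  · exact fun h => le_sSup h

/-- Pure elements. -/
def IsPure (a : A) : Prop := ∀ c : A, IsCompactElement c → c ≤ a → a ⊔ perp c = ⊤

/-- A `PF`-quantale: the annihilator of every compact element is pure. -/
def IsPF (A : Type*) [CommMonoid A] [CompleteLattice A] : Prop :=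
  ∀ c : A, IsCompactElement c → IsPure (perp c)

/-- A `PP`-quantale: the annihilator of every compact element is complemented. -/
def IsPP (A : Type*) [CommMonoid A] [CompleteLattice A] : Prop :=
  ∀ c : A, IsCompactElement c → IsComplemented (perp c)

/-! ### The spectrum -/

/-- `m`-prime elements. -/
def IsMPrime (p : A) : Prop := p < ⊤ ∧ ∀ a b : A, a * b ≤ p → a ≤ p ∨ b ≤ p

end Basic

/-- The set `Spec(A)` of `m`-prime elements. -/
@[ext]
structure MSpec (A : Type*) [CommMonoid A] [CompleteLattice A] where
  val : A
  isMPrime : IsMPrime val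

namespace MSpec

variable {A : Type*} [CommMonoid A] [CompleteLattice A]

instance : PartialOrder (MSpec A) := PartialOrder.lift MSpec.val fun _ _ => MSpec.ext

/-- `D(a)`, the set of the `m`-primes that are not above `a`. -/
def D (a : A) : Set (MSpec A) := {p | ¬ a ≤ p.val}

/-- The space `Spec_Z(A)`: the open sets are exactly the sets `D(a)`, that is, the closed sets
are exactly the sets `V(a)` of the `m`-primes above `a`. -/
instance [IsIntegralQuantale A] : TopologicalSpace (MSpec A) where
  IsOpen U := ∃ a : A, U = D a
  isOpen_univ := ⟨⊤, by
    ext p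
    simpa [D] using p.isMPrime.1.ne⟩
  isOpen_inter := by
    rintro _ _ ⟨a, rfl⟩ ⟨b, rfl⟩
    refine ⟨a * b, Set.ext fun p => ⟨fun h hab => ?_, fun h => ⟨fun ha => h ?_, fun hb => h ?_⟩⟩⟩
    · exact (p.isMPrime.2 a b hab).elim h.1 h.2
    · exact (mul_le_left_of_integral a b).trans ha
    · exact (mul_le_right_of_integral a b).trans hb
  isOpen_sUnion := by
    intro S hS
    refine ⟨sSup {a | D a ∈ S}, Set.ext fun p => ?_⟩
    simp only [Set.mem_sUnion, D, Set.mem_ofPred_eq, sSup_le_iff, not_forall]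
    constructor
    · rintro ⟨U, hU, hp⟩
      obtain ⟨a, rfl⟩ := hS U hU
      exact ⟨a, hU, hp⟩
    · rintro ⟨a, ha, hp⟩
      exact ⟨_, ha, hp⟩

/-- The set `Min(A)` of minimal `m`-primes; as a subspace of `MSpec A` it is `Min_Z(A)`. -/
def minimals (A : Type*) [CommMonoid A] [CompleteLattice A] : Set (MSpec A) := {p | IsMin p}

end MSpec

/-! ### The frame of pure elements -/

/-- The set `Vir(A)` of pure elements. -/
@[ext]
structure Vir (A : Type*) [CommMonoid A] [CompleteLattice A] where
  val : A
  isPure : IsPure val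

section Vir

variable {A : Type*} [CommMonoid A] [CompleteLattice A]

theorem sup_mul_eq_top [IsIntegralQuantale A] {a b x : A} (ha : a ⊔ x = ⊤) (hb : b ⊔ x = ⊤) :
    a * b ⊔ x = ⊤ := by
  have h : (a ⊔ x) * (b ⊔ x) = ⊤ := by
    rw [ha, hb, ← IsIntegralQuantale.one_eq_top, one_mul]
  refine top_le_iff.1 (h ▸ ?_)
  rw [Quantale.sup_mul_distrib, Quantale.mul_sup_distrib]
  exact sup_le (sup_le le_sup_left ((mul_le_right_of_integral a x).trans le_sup_right))
    ((mul_le_left_of_integral x _).trans le_sup_right)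

theorem perp_anti [IsQuantale A] {a b : A} (h : a ≤ b) : perp b ≤ perp a := by
  rw [le_perp_iff]
  exact le_bot_iff.1 ((mul_le_mul_left h _).trans (le_perp_iff.1 le_rfl).le)

theorem IsPure.top [IsIntegralQuantale A] : IsPure (⊤ : A) := fun _ _ _ => top_sup_eq _

theorem IsPure.mul [IsIntegralQuantale A] {a b : A} (ha : IsPure a) (hb : IsPure b) :
    IsPure (a * b) := fun c hc h =>
  sup_mul_eq_top (ha c hc (h.trans (mul_le_left_of_integral a b)))
    (hb c hc (h.trans (mul_le_right_of_integral a b)))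

theorem isPure_sSup [IsCoherentQuantale A] {S : Set A} (hS : ∀ a ∈ S, IsPure a) :
    IsPure (sSup S) := by
  classical
  intro c hc hcS
  have h1 : sSup S ≤ sSup {d : A | IsCompactElement d ∧ ∃ a ∈ S, d ≤ a} := by
    refine sSup_le fun a ha => ?_
    rw [← sSup_compact_le_eq a]
    exact sSup_le_sSup fun d hd => ⟨hd.1, a, ha, hd.2⟩
  obtain ⟨t, ht, hct⟩ :=
    (CompleteLattice.isCompactElement_iff_exists_le_sSup_of_le_sSup A c).1 hc _ (hcS.trans h1)
  have key : ∀ t : Finset A, (↑t ⊆ {d : A | IsCompactElement d ∧ ∃ a ∈ S, d ≤ a}) →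
      sSup S ⊔ perp (t.sup id) = ⊤ := by
    intro t
    induction t using Finset.induction_on with
    | empty =>
      intro _
      refine top_le_iff.1 (le_trans ?_ le_sup_right)
      rw [Finset.sup_empty, le_perp_iff, Quantale.bot_mul]
    | insert d t _ ih =>
      intro h
      rw [Finset.coe_insert, Set.insert_subset_iff] at h
      obtain ⟨⟨hd, a, ha, hda⟩, h⟩ := h
      have hd' : perp d ⊔ sSup S = ⊤ :=
        top_le_iff.1 ((hS a ha d hd hda).ge.trans
          (sup_le ((le_sSup ha).trans le_sup_right) le_sup_left))
      have h2 := sup_mul_eq_top hd' ((sup_comm _ _).trans (ih h))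
      refine top_le_iff.1 (h2.ge.trans (sup_le (le_trans ?_ le_sup_right) le_sup_left))
      rw [le_perp_iff, Finset.sup_insert, Quantale.sup_mul_distrib, id]
      refine le_bot_iff.1 (sup_le ?_ ?_)
      · exact (mul_le_mul_right (mul_le_left_of_integral _ _) d).trans
          (le_perp_iff.1 le_rfl).le
      · exact (mul_le_mul_right (mul_le_right_of_integral _ _) _).trans
          (le_perp_iff.1 le_rfl).le
  exact top_le_iff.1 ((key t ht).ge.trans (sup_le_sup_left (perp_anti hct) _))

/-- A pure element absorbs the elements below it. -/
theorem IsPure.inf_le_mul [IsCoherentQuantale A] {a b : A} (ha : IsPure a) :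
    b ⊓ a ≤ b * a := by
  refine le_iff_compact_le_imp.2 fun c hc h => ?_
  calc c = c * (a ⊔ perp c) := by
        rw [ha c hc (h.trans inf_le_right), ← IsIntegralQuantale.one_eq_top, mul_one]
    _ = c * a := by rw [Quantale.mul_sup_distrib, le_perp_iff.1 le_rfl, sup_bot_eq]
    _ ≤ b * a := mul_le_mul_left (h.trans inf_le_left) a

namespace Vir

instance : PartialOrder (Vir A) := PartialOrder.lift Vir.val fun _ _ => Vir.ext

instance [IsCoherentQuantale A] : SupSet (Vir A) where
  sSup S := ⟨sSup (Vir.val '' S), isPure_sSup (by rintro _ ⟨a, _, rfl⟩; exact a.2)⟩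

/-- Joins of pure elements are computed in `A`. -/
instance [IsCoherentQuantale A] : CompleteLattice (Vir A) :=
  completeLatticeOfSup (Vir A) fun S =>
    ⟨fun a ha => le_sSup (a := a.val) ⟨a, ha, rfl⟩,
      fun b hb => sSup_le (a := b.val) (by rintro _ ⟨a, ha, rfl⟩; exact hb ha)⟩

/-- The multiplication of pure elements is that of `A`. -/
instance [IsCoherentQuantale A] : CommMonoid (Vir A) where
  mul a b := ⟨a.val * b.val, a.isPure.mul b.isPure⟩
  one := ⟨1, IsIntegralQuantale.one_eq_top (A := A) ▸ IsPure.top⟩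
  mul_assoc a b c := Vir.ext (mul_assoc a.val b.val c.val)
  one_mul a := Vir.ext (one_mul a.val)
  mul_one a := Vir.ext (mul_one a.val)
  mul_comm a b := Vir.ext (mul_comm a.val b.val)

theorem val_sSup [IsCoherentQuantale A] (S : Set (Vir A)) :
    (sSup S).1 = sSup (Vir.val '' S) := rfl

theorem val_mul [IsCoherentQuantale A] (a b : Vir A) : (a * b).1 = a.val * b.val := rfl

/-- The multiplication of `Vir A` is the meet: `Vir A` is a frame. -/
theorem mul_eq_inf [IsCoherentQuantale A] (a b : Vir A) : a * b = a ⊓ b := by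
  refine le_antisymm (le_inf ?_ ?_) ?_
  · exact mul_le_left_of_integral a.val b.val
  · exact mul_le_right_of_integral a.val b.val
  · exact (le_inf (a := a.val) (b := b.val) (show (a ⊓ b).1 ≤ a.val from inf_le_left (a := a))
      (show (a ⊓ b).1 ≤ b.val from inf_le_right (a := a))).trans b.isPure.inf_le_mul

instance [IsCoherentQuantale A] : IsIntegralQuantale (Vir A) where
  one_eq_top := by
    refine top_le_iff.1 ?_
    change (⊤ : Vir A).1 ≤ (1 : A)
    exact IsIntegralQuantale.one_eq_top (A := A) ▸ le_top
  mul_sSup_distrib a S := by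
    rw [← sSup_image]
    refine Vir.ext ?_
    rw [val_mul, val_sSup, val_sSup, mul_sSup_distrib, ← sSup_image, Set.image_image,
      Set.image_image]
    rfl
  sSup_mul_distrib S a := by
    rw [← sSup_image]
    refine Vir.ext ?_
    rw [val_mul, val_sSup, val_sSup, sSup_mul_distrib, ← sSup_image, Set.image_image,
      Set.image_image]
    rfl

end Vir

end Vir

/-! ### The reticulation -/

/-- The set `K(A)` of compact elements. -/
structure CompactElt (A : Type*) [CompleteLattice A] where
  val : A
  isCompact : IsCompactElement val

theorem isCompactElement_sup {A : Type*} [CompleteLattice A] {c d : A} (hc : IsCompactElement c) (hd : IsCompactElement d) :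
    IsCompactElement (c ⊔ d) := by
  classical
  have := CompleteLattice.isCompactElement_finsetSup (f := id) ({c, d} : Finset A)
    (by intro x hx; simp only [Finset.mem_insert, Finset.mem_singleton] at hx
        rcases hx with rfl | rfl <;> assumption)
  simpa using this

theorem isCompactElement_bot {A : Type*} [CompleteLattice A] : IsCompactElement (⊥ : A) := by
  simpa using CompleteLattice.isCompactElement_finsetSup (f := id) (∅ : Finset A) (by simp)

section Reticulation

variable {A : Type*} [CommMonoid A] [CompleteLattice A]

/-- Some positive power of `c` is below `d`. -/
def PowLE (c d : A) : Prop := ∃ n : ℕ, 1 ≤ n ∧ c ^ n ≤ d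

theorem PowLE.of_le {c d : A} (h : c ≤ d) : PowLE c d := ⟨1, le_rfl, by rwa [pow_one]⟩

theorem PowLE.trans [IsQuantale A] {c d e : A} : PowLE c d → PowLE d e → PowLE c e := by
  rintro ⟨n, hn, h⟩ ⟨m, hm, h'⟩
  exact ⟨n * m, Nat.mul_pos hn hm, by
    rw [pow_mul]
    exact (pow_le_pow_left' h m).trans h'⟩

theorem PowLE.mul [IsIntegralQuantale A] {c d e : A} :
    PowLE c d → PowLE c e → PowLE c (d * e) := by
  rintro ⟨n, hn, h⟩ ⟨m, hm, h'⟩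
  exact ⟨n + m, by omega, by
    rw [pow_add]
    exact mul_le_mul' h h'⟩

theorem sup_pow_le [IsIntegralQuantale A] (c d : A) (n m : ℕ) :
    (c ⊔ d) ^ (n + m) ≤ c ^ n ⊔ d ^ m := by
  induction n generalizing m with
  | zero =>
    refine le_trans ?_ le_sup_left
    rw [pow_zero, IsIntegralQuantale.one_eq_top (A := A)]
    exact le_top
  | succ n ih =>
    induction m with
    | zero =>
      refine le_trans ?_ le_sup_right
      rw [pow_zero, IsIntegralQuantale.one_eq_top (A := A)]
      exact le_top
    | succ m ihm =>
      have e : (c ⊔ d) ^ (n + 1 + (m + 1)) =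
          c * (c ⊔ d) ^ (n + (m + 1)) ⊔ d * (c ⊔ d) ^ (n + 1 + m) := by
        rw [show n + 1 + (m + 1) = n + m + 1 + 1 by omega, pow_succ', Quantale.sup_mul_distrib,
          show n + (m + 1) = n + m + 1 by omega, show n + 1 + m = n + m + 1 by omega]
      rw [e]
      refine sup_le ((mul_le_mul_right (ih (m + 1)) c).trans ?_)
        ((mul_le_mul_right ihm d).trans ?_)
      · rw [Quantale.mul_sup_distrib, ← pow_succ']
        exact sup_le_sup_left (mul_le_right_of_integral _ _) _
      · rw [Quantale.mul_sup_distrib, ← pow_succ']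
        exact sup_le_sup_right (mul_le_right_of_integral _ _) _

theorem PowLE.sup [IsIntegralQuantale A] {c d e : A} :
    PowLE c e → PowLE d e → PowLE (c ⊔ d) e := by
  rintro ⟨n, hn, h⟩ ⟨m, hm, h'⟩
  exact ⟨n + m, by omega, (sup_pow_le c d n m).trans (sup_le h h')⟩

/-- Two compact elements are identified if each has a positive power below the other. -/
def reticulationSetoid (A : Type*) [CommMonoid A] [CompleteLattice A] [IsQuantale A] :
    Setoid (CompactElt A) where
  r c d := PowLE c.val d.val ∧ PowLE d.val c.val
  iseqv := ⟨fun _ => ⟨.of_le le_rfl, .of_le le_rfl⟩, fun h => ⟨h.2, h.1⟩,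
    fun h h' => ⟨h.1.trans h'.1, h'.2.trans h.2⟩⟩

/-- The reticulation `L(A)`. -/
def Reticulation (A : Type*) [CommMonoid A] [CompleteLattice A] [IsQuantale A] : Type _ :=
  Quotient (reticulationSetoid A)

namespace Reticulation

/-- The canonical map `λ_A : K(A) → L(A)`. -/
def mk [IsQuantale A] (c : CompactElt A) : Reticulation A :=
  Quotient.mk (reticulationSetoid A) c

theorem mk_surjective [IsQuantale A] : Function.Surjective (mk : CompactElt A → _) :=
  Quotient.mk_surjective

instance [IsQuantale A] : PartialOrder (Reticulation A) where
  le x y := Quotient.liftOn₂ x y (fun c d => PowLE c.val d.val) fun _ _ _ _ h h' =>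
    propext ⟨fun k => (h.2.trans k).trans h'.1, fun k => (h.1.trans k).trans h'.2⟩
  le_refl x := Quotient.inductionOn x fun _ => PowLE.of_le le_rfl
  le_trans x y z := Quotient.inductionOn₃ x y z fun _ _ _ h h' => PowLE.trans h h'
  le_antisymm x y := Quotient.inductionOn₂ x y fun _ _ h h' => Quotient.sound ⟨h, h'⟩

theorem mk_le_mk [IsQuantale A] {c d : CompactElt A} : mk c ≤ mk d ↔ PowLE c.val d.val := Iff.rfl

instance [IsCoherentQuantale A] : Lattice (Reticulation A) where
  sup := Quotient.map₂ (fun c d => ⟨c.val ⊔ d.val, isCompactElement_sup c.isCompact d.isCompact⟩)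
    fun _ _ h _ _ h' =>
      ⟨.sup (h.1.trans (.of_le le_sup_left)) (h'.1.trans (.of_le le_sup_right)),
        .sup (h.2.trans (.of_le le_sup_left)) (h'.2.trans (.of_le le_sup_right))⟩
  inf := Quotient.map₂
    (fun c d => ⟨c.val * d.val, IsCoherentQuantale.isCompactElement_mul _ _ c.isCompact d.isCompact⟩)
    fun _ _ h _ _ h' =>
      ⟨.mul (.trans (.of_le (mul_le_left_of_integral _ _)) h.1)
          (.trans (.of_le (mul_le_right_of_integral _ _)) h'.1),
        .mul (.trans (.of_le (mul_le_left_of_integral _ _)) h.2)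
          (.trans (.of_le (mul_le_right_of_integral _ _)) h'.2)⟩
  le_sup_left x y := Quotient.inductionOn₂ x y fun _ _ => PowLE.of_le le_sup_left
  le_sup_right x y := Quotient.inductionOn₂ x y fun _ _ => PowLE.of_le le_sup_right
  sup_le x y z := Quotient.inductionOn₃ x y z fun _ _ _ h h' => PowLE.sup h h'
  inf_le_left x y := Quotient.inductionOn₂ x y fun _ _ =>
    PowLE.of_le (mul_le_left_of_integral _ _)
  inf_le_right x y := Quotient.inductionOn₂ x y fun _ _ =>
    PowLE.of_le (mul_le_right_of_integral _ _)
  le_inf x y z := Quotient.inductionOn₃ x y z fun _ _ _ h h' => PowLE.mul h h'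

theorem mk_sup [IsCoherentQuantale A] (c d : CompactElt A) :
    mk ⟨c.val ⊔ d.val, isCompactElement_sup c.isCompact d.isCompact⟩ = mk c ⊔ mk d := rfl

theorem mk_mul [IsCoherentQuantale A] (c d : CompactElt A) :
    mk ⟨c.val * d.val, IsCoherentQuantale.isCompactElement_mul _ _ c.isCompact d.isCompact⟩ = mk c ⊓ mk d := rfl

instance [IsCoherentQuantale A] : DistribLattice (Reticulation A) where
  le_sup_inf x y z := Quotient.inductionOn₃ x y z fun a b c => PowLE.of_le <| by
    change (a.val ⊔ b.val) * (a.val ⊔ c.val) ≤ a.val ⊔ b.val * c.val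
    rw [Quantale.sup_mul_distrib, Quantale.mul_sup_distrib (x := b.val)]
    exact sup_le ((mul_le_left_of_integral _ _).trans le_sup_left)
      (sup_le ((mul_le_right_of_integral _ _).trans le_sup_left) le_sup_right)

instance [IsCoherentQuantale A] : BoundedOrder (Reticulation A) where
  top := mk ⟨⊤, IsCoherentQuantale.isCompactElement_top⟩
  bot := mk ⟨⊥, isCompactElement_bot⟩
  le_top x := Quotient.inductionOn x fun _ => PowLE.of_le le_top
  bot_le x := Quotient.inductionOn x fun _ => PowLE.of_le bot_le

end Reticulation

/-- The axioms of a reticulation `(L, λ)` of `A`. By surjectivity and the third clause they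
determine `(L, λ)` up to a unique isomorphism. -/
structure IsReticulation [IsCoherentQuantale A] {L : Type*} [DistribLattice L] [BoundedOrder L]
    (lam : CompactElt A → L) : Prop where
  surjective : Function.Surjective lam
  map_sup_le : ∀ c d : CompactElt A,
    lam ⟨c.val ⊔ d.val, isCompactElement_sup c.isCompact d.isCompact⟩ ≤ lam c ⊔ lam d
  map_mul : ∀ c d : CompactElt A,
    lam ⟨c.val * d.val, IsCoherentQuantale.isCompactElement_mul _ _ c.isCompact d.isCompact⟩ = lam c ⊓ lam d
  map_le_map_iff : ∀ c d : CompactElt A, lam c ≤ lam d ↔ ∃ n : ℕ, 1 ≤ n ∧ c.val ^ n ≤ d.val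

theorem Reticulation.isReticulation [IsCoherentQuantale A] :
    IsReticulation (mk : CompactElt A → Reticulation A) where
  surjective := mk_surjective
  map_sup_le c d := (mk_sup c d).le
  map_mul := mk_mul
  map_le_map_iff _ _ := mk_le_mk

end Reticulation

/-! ### Bounded distributive lattices -/

/-- A Stone lattice: the annihilator of every element is the principal ideal generated by a
complemented element. -/
def IsStoneLattice (L : Type*) [DistribLattice L] [BoundedOrder L] : Prop :=
  ∀ x : L, ∃ e : L, IsComplemented e ∧ {y : L | x ⊓ y = ⊥} = Set.Iic e

/-- The set `Spec_Id(L)` of prime ideals. -/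
@[ext]
structure IdSpec (L : Type*) [DistribLattice L] [BoundedOrder L] where
  val : Order.Ideal L
  isPrime : val.IsPrime

namespace IdSpec

variable {L : Type*} [DistribLattice L] [BoundedOrder L]

instance : PartialOrder (IdSpec L) := PartialOrder.lift IdSpec.val fun _ _ => IdSpec.ext

/-- The space `Spec_{Id,Z}(L)`: the topology generated by the sets `{P | x ∉ P}`, which form
a basis because `L` is a lattice. -/
instance : TopologicalSpace (IdSpec L) :=
  TopologicalSpace.generateFrom (Set.range fun x : L => {P : IdSpec L | x ∉ P.val})

/-- The set `Min_Id(L)` of minimal prime ideals; as a subspace of `IdSpec L` it is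
`Min_{Id,Z}(L)`. -/
def minimals (L : Type*) [DistribLattice L] [BoundedOrder L] : Set (IdSpec L) := {P | IsMin P}

end IdSpec

/-- The inclusion of the subspace `S` into `X` has a continuous retraction. -/
def HasContinuousRetraction {X : Type*} [TopologicalSpace X] (S : Set X) : Prop :=
  ∃ r : X → S, Continuous r ∧ ∀ p : S, r p = p

end PPQuantale

open PPQuantale

/-!
For an `m`-prime `p` let `O(p)` be the join of the compact `c` with `c^⊥ ≰ p`. In a `PF`-quantale
`O(p)` is pure and `m`-prime, so it is the unique minimal `m`-prime below `p`, and the minimal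
`m`-primes are exactly the pure ones. Consequently, for compact `c`, an element `e` is a complement
of `c^⊥` if and only if `e` is pure and lies below the same minimal `m`-primes as `c`. Each of the
topological conditions produces such an `e` for every `c`: compactness of `Min_Z(A)` gives `e = d^⊥`
with `d ≤ c^⊥` compact, and an open subset of `Spec_Z(Vir(A))` is a `D(e)` with `e` pure.
Conversely, the complements `e` make `p ↦ O(p)` a continuous retraction. The conditions on the
reticulation are transported along the homeomorphism of `Spec_Z(A)` with `Spec_{Id,Z}(L(A))`, and
along the bijection between complemented elements, available because `A` has no nilpotents.
-/

namespace PPQuantale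

/-! ### Annihilators and complements -/

section Quantale

variable {A : Type*} [CommMonoid A] [CompleteLattice A]

theorem IsMPrime.le_of_powLE {p c : A} (hp : IsMPrime p) (h : PowLE c p) : c ≤ p := by
  obtain ⟨n, hn, hcp⟩ := h
  induction n, hn using Nat.le_induction with
  | base => rwa [pow_one] at hcp
  | succ n _ ih => exact (hp.2 _ _ (pow_succ c n ▸ hcp)).elim ih id

variable [IsQuantale A]

theorem mul_perp (a : A) : a * perp a = ⊥ := le_perp_iff.1 le_rfl

theorem perp_bot : perp (⊥ : A) = ⊤ := top_le_iff.1 (le_perp_iff.2 Quantale.bot_mul)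

theorem le_perp_comm {a b : A} : a ≤ perp b ↔ b ≤ perp a := by
  rw [le_perp_iff, le_perp_iff, mul_comm]

theorem le_perp_perp (a : A) : a ≤ perp (perp a) := le_perp_comm.1 le_rfl

theorem mul_le_perp_iff {a b c : A} : a * b ≤ perp c ↔ a ≤ perp (b * c) := by
  rw [le_perp_iff, le_perp_iff, show c * (a * b) = b * c * a by ac_rfl]

theorem perp_sup (a b : A) : perp (a ⊔ b) = perp a ⊓ perp b :=
  eq_of_forall_le_iff fun x => by
    rw [le_inf_iff, le_perp_iff, le_perp_iff, le_perp_iff, Quantale.sup_mul_distrib,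
      sup_eq_bot_iff]

theorem perp_perp_mul_perp_perp_le (a b : A) :
    perp (perp a) * perp (perp b) ≤ perp (perp (a * b)) := by
  have h₁ : perp (a * b) * a ≤ perp (perp (perp b)) :=
    (mul_le_perp_iff.2 le_rfl).trans (le_perp_perp _)
  have h₂ : perp (perp b) * perp (a * b) ≤ perp (perp (perp a)) :=
    (mul_le_perp_iff.2 (le_perp_comm.1 h₁)).trans (le_perp_perp _)
  exact mul_le_perp_iff.2 (le_perp_comm.1 h₂)

theorem IsMPrime.le_or_perp_le {p : A} (hp : IsMPrime p) (a : A) : a ≤ p ∨ perp a ≤ p :=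
  hp.2 a (perp a) ((mul_perp a).le.trans bot_le)

theorem IsPF.codisjoint_perp (hPF : IsPF A) {c d : A} (hc : IsCompactElement c)
    (hd : IsCompactElement d) (h : c * d = ⊥) : Codisjoint (perp c) (perp d) :=
  codisjoint_iff.2 (hPF c hc d hd (le_perp_iff.2 h))

end Quantale

section IntegralQuantale

variable {A : Type*} [CommMonoid A] [CompleteLattice A] [IsIntegralQuantale A]

theorem mul_top_of_integral (a : A) : a * ⊤ = a := by
  rw [← IsIntegralQuantale.one_eq_top, mul_one]

theorem le_one_of_integral (a : A) : a ≤ 1 := le_top.trans IsIntegralQuantale.one_eq_top.ge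

theorem le_of_codisjoint_of_mul_le {a b c : A} (h : Codisjoint a b) (hc : c * b ≤ a) : c ≤ a :=
  calc
    c = c * (a ⊔ b) := by rw [h.eq_top, mul_top_of_integral]
    _ = c * a ⊔ c * b := Quantale.mul_sup_distrib
    _ ≤ a := sup_le (mul_le_right_of_integral c a) hc

theorem inf_eq_mul_of_codisjoint {a b : A} (h : Codisjoint a b) : a ⊓ b = a * b := by
  refine le_antisymm ?_ (le_inf (mul_le_left_of_integral a b) (mul_le_right_of_integral a b))
  calc
    a ⊓ b = (a ⊓ b) * (a ⊔ b) := by rw [h.eq_top, mul_top_of_integral]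
    _ = (a ⊓ b) * a ⊔ (a ⊓ b) * b := Quantale.mul_sup_distrib
    _ ≤ b * a ⊔ a * b := sup_le_sup (mul_le_mul_left inf_le_right a) (mul_le_mul_left inf_le_left b)
    _ = a * b := by rw [mul_comm, sup_idem]

theorem isCompl_iff_codisjoint_and_mul_eq_bot {a b : A} :
    IsCompl a b ↔ Codisjoint a b ∧ a * b = ⊥ := by
  rw [isCompl_iff, and_comm, disjoint_iff]
  exact and_congr_right fun h => by rw [inf_eq_mul_of_codisjoint h]

theorem perp_eq_of_isCompl {a b : A} (h : IsCompl a b) : perp a = b := by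
  obtain ⟨hcod, hmul⟩ := isCompl_iff_codisjoint_and_mul_eq_bot.1 h
  refine le_antisymm (le_of_codisjoint_of_mul_le hcod.symm ?_) (le_perp_iff.2 hmul)
  rw [mul_comm, mul_perp]
  exact bot_le

theorem isPure_of_isCompl {a b : A} (h : IsCompl a b) : IsPure a := by
  intro c _ hca
  have hb : b ≤ perp c := perp_eq_of_isCompl h ▸ perp_anti hca
  exact (h.codisjoint.mono_right hb).eq_top

theorem IsPP.isPF (hPP : IsPP A) : IsPF A := fun c hc =>
  (hPP c hc).elim fun _ he => isPure_of_isCompl he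

theorem isCompactElement_of_isCompl (htop : IsCompactElement (⊤ : A)) {a b : A}
    (h : IsCompl a b) : IsCompactElement a := by
  obtain ⟨hcod, hmul⟩ := isCompl_iff_codisjoint_and_mul_eq_bot.1 h
  rw [CompleteLattice.isCompactElement_iff_le_of_directed_sSup_le] at htop ⊢
  intro s hs hdir has
  have hcover : ⊤ ≤ sSup ((· ⊔ b) '' s) := by
    rw [sSup_image, ← biSup_sup hs, ← sSup_eq_iSup]
    exact (hcod.mono_left has).top_le
  have hdir' : DirectedOn (· ≤ ·) ((· ⊔ b) '' s) :=
    hdir.mono_comp fun _ _ hxy => sup_le_sup_right hxy b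
  obtain ⟨_, ⟨x, hx, rfl⟩, hxb⟩ := htop _ (hs.image _) hdir' hcover
  exact ⟨x, hx, le_of_codisjoint_of_mul_le (codisjoint_iff_le_sup.2 hxb) (hmul.le.trans bot_le)⟩

theorem IsMPrime.le_of_inf_le {p a b : A} (hp : IsMPrime p) (h : a ⊓ b ≤ p) : a ≤ p ∨ b ≤ p :=
  hp.2 a b ((le_inf (mul_le_left_of_integral a b) (mul_le_right_of_integral a b)).trans h)

theorem IsMPrime.le_iff_not_le_of_isCompl {p a b : A} (hp : IsMPrime p) (h : IsCompl a b) :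
    a ≤ p ↔ ¬ b ≤ p :=
  ⟨fun ha hb => hp.1.not_ge (h.codisjoint.top_le.trans (sup_le ha hb)),
    (hp.le_of_inf_le (h.inf_eq_bot.le.trans bot_le)).resolve_right⟩

end IntegralQuantale

/-! ### Semiprime quantales -/

/-- A semiprime quantale: one without nonzero nilpotent elements. The exponent `0` is harmless:
in an integral quantale `a ^ 0 = ⊥` says that `⊤ = ⊥`. -/
def IsSemiprime (A : Type*) [CommMonoid A] [CompleteLattice A] : Prop :=
  ∀ (a : A) (n : ℕ), a ^ n = ⊥ → a = ⊥

section CompactlyGenerated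

variable {A : Type*} [CompleteLattice A] [IsCompactlyGenerated A]

theorem exists_isCompactElement_of_not_le {a b : A} (h : ¬ a ≤ b) :
    ∃ c : A, IsCompactElement c ∧ c ≤ a ∧ ¬ c ≤ b := by
  simpa only [not_forall, exists_prop] using mt le_iff_compact_le_imp.2 h

theorem eq_of_forall_isCompactElement_le_iff {a b : A}
    (h : ∀ c : A, IsCompactElement c → (c ≤ a ↔ c ≤ b)) : a = b :=
  le_antisymm (le_iff_compact_le_imp.2 fun c hc => (h c hc).1)
    (le_iff_compact_le_imp.2 fun c hc => (h c hc).2)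

variable [CommMonoid A] [IsIntegralQuantale A]

theorem IsPF.eq_bot_of_mul_self (hPF : IsPF A) {a : A} (h : a * a = ⊥) : a = ⊥ := by
  refine le_bot_iff.1 (le_iff_compact_le_imp.2 fun c hc hca => ?_)
  have hcc : c * c = ⊥ := le_bot_iff.1 ((mul_le_mul' hca hca).trans h.le)
  have hperp : perp c = ⊤ := codisjoint_self.1 (hPF.codisjoint_perp hc hc hcc)
  rw [← mul_top_of_integral c, ← hperp, mul_perp]

theorem IsPF.isSemiprime (hPF : IsPF A) : IsSemiprime A := by
  intro a n
  induction n with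
  | zero =>
    intro h
    exact le_bot_iff.1 ((le_one_of_integral a).trans (by rw [← h, pow_zero]))
  | succ n ih =>
    intro h
    rcases n.eq_zero_or_pos with rfl | hn
    · rwa [zero_add, pow_one] at h
    · refine ih (hPF.eq_bot_of_mul_self (le_bot_iff.1 ?_))
      rw [← pow_add, ← h]
      exact pow_le_pow_right_of_le_one' (le_one_of_integral a) (by omega)

end CompactlyGenerated

section Semiprime

variable {A : Type*} [CommMonoid A] [CompleteLattice A]

theorem IsSemiprime.eq_bot_of_powLE_bot (hA : IsSemiprime A) {a : A} (h : PowLE a ⊥) : a = ⊥ :=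
  h.elim fun n hn => hA a n (le_bot_iff.1 hn.2)

theorem IsSemiprime.powLE_perp_iff [IsIntegralQuantale A] (hA : IsSemiprime A) {c d : A} :
    PowLE d (perp c) ↔ d ≤ perp c := by
  refine ⟨fun h => le_perp_iff.2 (hA.eq_bot_of_powLE_bot ?_), PowLE.of_le⟩
  rw [← mul_perp c]
  exact (PowLE.of_le (mul_le_left_of_integral c d)).mul
    ((PowLE.of_le (mul_le_right_of_integral c d)).trans h)

end Semiprime

/-! ### Existence of `m`-prime elements -/

section Existence

variable {A : Type*} [CommMonoid A] [CompleteLattice A]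

theorem isMPrime_of_maximal [IsIntegralQuantale A] {S : Submonoid A} {p : A}
    (hp : Maximal (fun x => ∀ s ∈ S, ¬ s ≤ x) p) : IsMPrime p := by
  have exists_le_sup : ∀ a : A, ¬ a ≤ p → ∃ s ∈ S, s ≤ p ⊔ a := by
    intro a ha
    by_contra! H
    exact ha (le_sup_right.trans (hp.2 H le_sup_left))
  refine ⟨lt_top_iff_ne_top.2 fun h => hp.1 1 S.one_mem (h ▸ le_top), fun a b hab => ?_⟩
  by_contra! H
  obtain ⟨s, hs, hsa⟩ := exists_le_sup a H.1
  obtain ⟨t, ht, htb⟩ := exists_le_sup b H.2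
  refine hp.1 (s * t) (S.mul_mem hs ht) ((mul_le_mul' hsa htb).trans ?_)
  rw [Quantale.sup_mul_distrib, Quantale.mul_sup_distrib (x := a)]
  exact sup_le (mul_le_left_of_integral _ _) (sup_le (mul_le_right_of_integral _ _) hab)

theorem exists_isMPrime_ge_forall_not_le [IsIntegralQuantale A] {S : Submonoid A}
    (hS : ∀ s ∈ S, IsCompactElement s) {a : A} (ha : ∀ s ∈ S, ¬ s ≤ a) :
    ∃ p : A, IsMPrime p ∧ a ≤ p ∧ ∀ s ∈ S, ¬ s ≤ p := by
  obtain ⟨p, hap, hp⟩ := zorn_le_nonempty₀ {x : A | ∀ s ∈ S, ¬ s ≤ x} (fun C hC hchain y hy => by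
    refine ⟨sSup C, fun s hs hsC => ?_, fun z hz => le_sSup hz⟩
    obtain ⟨x, hx, hsx⟩ := hS s hs C _ ⟨y, hy⟩ hchain.directedOn (isLUB_sSup C) hsC
    exact hC hx s hs hsx) a ha
  exact ⟨p, isMPrime_of_maximal hp, hap, hp.1⟩

theorem isMPrime_of_forall_isCompactElement [IsQuantale A] [IsCompactlyGenerated A] {p : A}
    (hp : p < ⊤)
    (h : ∀ c d : A, IsCompactElement c → IsCompactElement d → c * d ≤ p → c ≤ p ∨ d ≤ p) :
    IsMPrime p := by
  refine ⟨hp, fun a b hab => ?_⟩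
  by_contra! H
  obtain ⟨c, hc, hca, hcp⟩ := exists_isCompactElement_of_not_le H.1
  obtain ⟨d, hd, hdb, hdp⟩ := exists_isCompactElement_of_not_le H.2
  exact (h c d hc hd ((mul_le_mul' hca hdb).trans hab)).elim hcp hdp

variable [IsCoherentQuantale A]

theorem isCompactElement_pow {c : A} (hc : IsCompactElement c) (n : ℕ) :
    IsCompactElement (c ^ n) := by
  induction n with
  | zero =>
    rw [pow_zero, IsIntegralQuantale.one_eq_top]
    exact IsCoherentQuantale.isCompactElement_top
  | succ n ih =>
    rw [pow_succ]
    exact IsCoherentQuantale.isCompactElement_mul _ _ ih hc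

theorem exists_isMPrime_ge {a : A} (ha : a ≠ ⊤) : ∃ p : A, IsMPrime p ∧ a ≤ p := by
  have one_isCompactElement : IsCompactElement (1 : A) :=
    pow_zero (⊤ : A) ▸ isCompactElement_pow IsCoherentQuantale.isCompactElement_top 0
  obtain ⟨p, hp, hap, -⟩ := exists_isMPrime_ge_forall_not_le (S := (⊥ : Submonoid A)) (a := a)
    (fun s hs => by rwa [Submonoid.mem_bot.1 hs])
    (fun s hs hsa => ha (top_le_iff.1 (by
      rwa [Submonoid.mem_bot.1 hs, IsIntegralQuantale.one_eq_top] at hsa)))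
  exact ⟨p, hp, hap⟩

theorem IsSemiprime.eq_bot_of_forall_isMPrime (hA : IsSemiprime A) {a : A}
    (h : ∀ p : A, IsMPrime p → a ≤ p) : a = ⊥ := by
  refine le_bot_iff.1 (le_iff_compact_le_imp.2 fun c hc hca => ?_)
  by_contra hc0
  obtain ⟨p, hp, -, hcp⟩ := exists_isMPrime_ge_forall_not_le (S := Submonoid.powers c) (a := ⊥)
    (by rintro _ ⟨n, rfl⟩; exact isCompactElement_pow hc n)
    (by rintro _ ⟨n, rfl⟩ hn; exact hc0 (hA c n (le_bot_iff.1 hn)).le)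
  exact hcp c (Submonoid.mem_powers c) (hca.trans (h p hp))

end Existence

/-! ### The element `O(p)` -/

section LocalKernel

variable {A : Type*} [CommMonoid A] [CompleteLattice A]

/-- The element `O(p)`, the join of the compact elements whose annihilator is not below `p`. For
the ideals of a commutative ring `R` it is the kernel of the localization `R → R_p`. -/
def localKernel (p : A) : A := sSup {c | IsCompactElement c ∧ ¬ perp c ≤ p}

theorem localKernel_le_of_le [IsQuantale A] {p q : A} (hq : IsMPrime q) (h : q ≤ p) :
    localKernel p ≤ q :=
  sSup_le fun c hc => (hq.le_or_perp_le c).resolve_right fun hcq => hc.2 (hcq.trans h)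

theorem IsMPrime.le_localKernel_iff [IsIntegralQuantale A] {p c : A} (hp : IsMPrime p)
    (hc : IsCompactElement c) : c ≤ localKernel p ↔ ¬ perp c ≤ p := by
  refine ⟨fun h hcp => ?_, fun h => le_sSup ⟨hc, h⟩⟩
  have hne : {c : A | IsCompactElement c ∧ ¬ perp c ≤ p}.Nonempty :=
    ⟨⊥, isCompactElement_bot, perp_bot (A := A) ▸ hp.1.not_ge⟩
  have hsup : SupClosed {c : A | IsCompactElement c ∧ ¬ perp c ≤ p} := fun a ha b hb =>
    ⟨isCompactElement_sup ha.1 hb.1, fun h =>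
      (hp.le_of_inf_le (perp_sup a b ▸ h)).elim ha.2 hb.2⟩
  obtain ⟨d, hd, hcd⟩ := hc _ _ hne hsup.directedOn (isLUB_sSup _) h
  exact hd.2 ((perp_anti hcd).trans hcp)

theorem IsPure.le_localKernel_iff [IsQuantale A] [IsCompactlyGenerated A] {a p : A}
    (ha : IsPure a) (hp : IsMPrime p) : a ≤ localKernel p ↔ a ≤ p := by
  refine ⟨fun h => h.trans (localKernel_le_of_le hp le_rfl), fun hap => ?_⟩
  refine le_iff_compact_le_imp.2 fun c hc hca => le_sSup ⟨hc, fun hcp => ?_⟩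
  exact hp.1.not_ge ((ha c hc hca).ge.trans (sup_le hap hcp))

theorem IsPF.isPure_localKernel [IsIntegralQuantale A] [IsCompactlyGenerated A] (hPF : IsPF A)
    {p : A} (hp : IsMPrime p) : IsPure (localKernel p) := by
  intro c hc hcp
  obtain ⟨d, hd, hdc, hdp⟩ :=
    exists_isCompactElement_of_not_le ((hp.le_localKernel_iff hc).1 hcp)
  have hcod : Codisjoint (perp d) (perp c) :=
    (hPF.codisjoint_perp hc hd (le_perp_iff.1 hdc)).symm
  have hle : perp d ≤ localKernel p := le_iff_compact_le_imp.2 fun x hx hxd =>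
    (hp.le_localKernel_iff hx).2 fun hxp => hdp ((le_perp_comm.1 hxd).trans hxp)
  exact (hcod.mono_left hle).eq_top

theorem IsPF.isMPrime_localKernel [IsCoherentQuantale A] (hPF : IsPF A) {p : A}
    (hp : IsMPrime p) : IsMPrime (localKernel p) := by
  refine isMPrime_of_forall_isCompactElement
    ((localKernel_le_of_le hp le_rfl).trans_lt hp.1) fun c d hc hd h => ?_
  rw [hp.le_localKernel_iff (IsCoherentQuantale.isCompactElement_mul c d hc hd)] at h
  rw [hp.le_localKernel_iff hc, hp.le_localKernel_iff hd]
  obtain ⟨x, hx, hxcd, hxp⟩ := exists_isCompactElement_of_not_le h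
  have hxcd' : x * c * d = ⊥ := by
    rw [mul_assoc, mul_comm, le_perp_iff.1 hxcd]
  have hcod : Codisjoint (perp (x * c)) (perp d) :=
    hPF.codisjoint_perp (IsCoherentQuantale.isCompactElement_mul x c hx hc) hd hxcd'
  by_contra! H
  have hxc : perp (x * c) * x ≤ p := (mul_le_perp_iff.2 le_rfl).trans H.1
  have hxc' : perp (x * c) ≤ p := (hp.2 _ _ hxc).resolve_right hxp
  exact hp.1.not_ge (hcod.top_le.trans (sup_le hxc' H.2))

end LocalKernel

/-! ### Minimal `m`-prime elements -/

namespace MSpec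

section Minimals

variable {A : Type*} [CommMonoid A] [CompleteLattice A]

theorem mem_minimals_of_isPure [IsQuantale A] [IsCompactlyGenerated A] {p : MSpec A}
    (h : IsPure p.val) : p ∈ minimals A := fun q hq =>
  calc
    p.val ≤ localKernel p.val := (h.le_localKernel_iff p.isMPrime).2 le_rfl
    _ ≤ q.val := localKernel_le_of_le q.isMPrime hq

variable [IsCoherentQuantale A]

/-- The minimal `m`-prime element `O(p)` below `p` in a `PF`-quantale. -/
def toMinimals (hPF : IsPF A) (p : MSpec A) : minimals A :=
  ⟨⟨localKernel p.val, hPF.isMPrime_localKernel p.isMPrime⟩,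
    mem_minimals_of_isPure (hPF.isPure_localKernel p.isMPrime)⟩

theorem toMinimals_le (hPF : IsPF A) (p : MSpec A) : (toMinimals hPF p : MSpec A) ≤ p :=
  localKernel_le_of_le p.isMPrime le_rfl

theorem toMinimals_of_mem (hPF : IsPF A) {p : MSpec A} (hp : p ∈ minimals A) :
    (toMinimals hPF p : MSpec A) = p :=
  le_antisymm (toMinimals_le hPF p) (hp (toMinimals_le hPF p))

theorem mem_minimals_iff_isPure (hPF : IsPF A) {p : MSpec A} :
    p ∈ minimals A ↔ IsPure p.val := by
  refine ⟨fun hp => ?_, mem_minimals_of_isPure⟩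
  rw [← toMinimals_of_mem hPF hp]
  exact hPF.isPure_localKernel p.isMPrime

theorem le_iff_not_perp_le (hPF : IsPF A) {p : MSpec A} (hp : p ∈ minimals A) {c : A}
    (hc : IsCompactElement c) : c ≤ p.val ↔ ¬ perp c ≤ p.val := by
  rw [← p.isMPrime.le_localKernel_iff hc]
  exact iff_of_eq (congrArg (c ≤ ·.val) (toMinimals_of_mem hPF hp).symm)

theorem eq_bot_of_forall_minimals (hPF : IsPF A) {a : A}
    (h : ∀ p ∈ minimals A, a ≤ p.val) : a = ⊥ :=
  hPF.isSemiprime.eq_bot_of_forall_isMPrime fun p hp =>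
    (h _ (toMinimals hPF ⟨p, hp⟩).2).trans (toMinimals_le hPF ⟨p, hp⟩)

theorem isCompl_perp_iff (hPF : IsPF A) {c e : A} (hc : IsCompactElement c) :
    IsCompl (perp c) e ↔ IsPure e ∧ ∀ p ∈ minimals A, c ≤ p.val ↔ e ≤ p.val := by
  constructor
  · refine fun h => ⟨isPure_of_isCompl h.symm, fun p hp => ?_⟩
    rw [le_iff_not_perp_le hPF hp hc, p.isMPrime.le_iff_not_le_of_isCompl h, not_not]
  rintro ⟨he, hmin⟩
  refine isCompl_iff_codisjoint_and_mul_eq_bot.2 ⟨codisjoint_iff.2 ?_, ?_⟩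
  · by_contra hne
    obtain ⟨p, hp, hle⟩ := exists_isMPrime_ge hne
    have hcp : c ≤ localKernel p := (hmin _ (toMinimals hPF ⟨p, hp⟩).2).2
      ((he.le_localKernel_iff hp).2 (le_sup_right.trans hle))
    exact (hp.le_localKernel_iff hc).1 hcp (le_sup_left.trans hle)
  · refine eq_bot_of_forall_minimals hPF fun p hp => ?_
    rcases p.isMPrime.le_or_perp_le c with hcp | hcp
    · exact (mul_le_right_of_integral _ _).trans ((hmin p hp).1 hcp)
    · exact (mul_le_left_of_integral _ _).trans hcp

end Minimals

/-! ### Retractions and compactness -/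

section Topology

variable {A : Type*} [CommMonoid A] [CompleteLattice A]

theorem isOpen_D [IsIntegralQuantale A] (a : A) : IsOpen (D a) := ⟨a, rfl⟩

theorem D_iSup {ι : Sort*} (a : ι → A) : D (⨆ i, a i) = ⋃ i, D (a i) := by
  ext p
  simp only [D, Set.mem_ofPred_eq, Set.mem_iUnion, iSup_le_iff, not_forall]

theorem D_top : D (⊤ : A) = Set.univ :=
  Set.eq_univ_of_forall fun p => p.isMPrime.1.not_ge

theorem isTopologicalBasis_D [IsIntegralQuantale A] [IsCompactlyGenerated A] :
    TopologicalSpace.IsTopologicalBasis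
      (Set.range fun c : CompactElt A => (D c.val : Set (MSpec A))) := by
  refine TopologicalSpace.isTopologicalBasis_of_isOpen_of_nhds ?_ ?_
  · rintro _ ⟨c, rfl⟩
    exact isOpen_D c.val
  · rintro p _ hp ⟨a, rfl⟩
    obtain ⟨c, hc, hca, hcp⟩ := exists_isCompactElement_of_not_le hp
    exact ⟨_, ⟨⟨c, hc⟩, rfl⟩, hcp, fun q hq h => hq (hca.trans h)⟩

variable [IsCoherentQuantale A]

theorem eq_top_of_D_eq_univ {a : A} (h : D a = Set.univ) : a = ⊤ := by
  by_contra ha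
  obtain ⟨p, hp, hap⟩ := exists_isMPrime_ge ha
  exact h.ge (Set.mem_univ ⟨p, hp⟩) hap

instance : CompactSpace (MSpec A) := by
  refine ⟨isCompact_of_finite_subcover fun U hU hcover => ?_⟩
  choose a ha using hU
  obtain rfl : U = fun i => D (a i) := funext ha
  rw [← D_iSup, Set.univ_subset_iff] at hcover
  obtain ⟨t, ht⟩ := CompleteLattice.IsCompactElement.exists_finset_of_le_iSup A
    IsCoherentQuantale.isCompactElement_top a (eq_top_of_D_eq_univ hcover).ge
  refine ⟨t, ?_⟩
  simp only [← D_iSup, top_le_iff.1 ht, D_top, subset_rfl]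

theorem continuous_toMinimals (hPP : IsPP A) : Continuous (toMinimals hPP.isPF) := by
  refine (isTopologicalBasis_D.continuous_iff.2 ?_).subtype_mk _
  rintro _ ⟨c, rfl⟩
  obtain ⟨e, he⟩ := hPP c.val c.isCompact
  obtain ⟨hpure, hmin⟩ := (isCompl_perp_iff hPP.isPF c.isCompact).1 he
  refine ⟨e, Set.ext fun p => not_congr ?_⟩
  exact (hmin _ (toMinimals hPP.isPF p).2).trans (hpure.le_localKernel_iff p.isMPrime)

theorem hasContinuousRetraction_minimals (hPP : IsPP A) : HasContinuousRetraction (minimals A) :=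
  ⟨toMinimals hPP.isPF, continuous_toMinimals hPP, fun p =>
    Subtype.ext (toMinimals_of_mem hPP.isPF p.2)⟩

theorem exists_perp_le_of_compactSpace_minimals (hPF : IsPF A) [CompactSpace (minimals A)] {c : A}
    (hc : IsCompactElement c) :
    ∃ d ≤ perp c, IsCompactElement d ∧ ∀ p ∈ minimals A, c ≤ p.val → ¬ d ≤ p.val := by
  have hclosed : IsClosed {p : minimals A | c ≤ p.1.val} :=
    ⟨(isOpen_D c).preimage continuous_subtype_val⟩
  let ι := {d : A // IsCompactElement d ∧ d ≤ perp c}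
  have : Nonempty ι := ⟨⟨⊥, isCompactElement_bot, bot_le⟩⟩
  have hcover : {p : minimals A | c ≤ p.1.val} ⊆ ⋃ d : ι, {p | ¬ d.1 ≤ p.1.val} := by
    intro p hp
    obtain ⟨d, hd, hdc, hdp⟩ :=
      exists_isCompactElement_of_not_le ((le_iff_not_perp_le hPF p.2 hc).1 hp)
    exact Set.mem_iUnion.2 ⟨⟨d, hd, hdc⟩, hdp⟩
  have hdir : Directed (· ⊆ ·) fun d : ι => {p : minimals A | ¬ d.1 ≤ p.1.val} := fun d e =>
    ⟨⟨d.1 ⊔ e.1, isCompactElement_sup d.2.1 e.2.1, sup_le d.2.2 e.2.2⟩,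
      fun _ hp h => hp (le_sup_left.trans h), fun _ hp h => hp (le_sup_right.trans h)⟩
  obtain ⟨⟨d, hd, hdc⟩, hcd⟩ := hclosed.isCompact.elim_directed_cover _
    (fun d : ι => (isOpen_D d.1).preimage continuous_subtype_val) hcover hdir
  exact ⟨d, hdc, hd, fun p hp hcp => hcd (a := ⟨p, hp⟩) hcp⟩

theorem isPP_of_compactSpace_minimals (hPF : IsPF A) [CompactSpace (minimals A)] : IsPP A := by
  intro c hc
  obtain ⟨d, hdc, hd, hcd⟩ := exists_perp_le_of_compactSpace_minimals hPF hc
  refine ⟨perp d, (isCompl_perp_iff hPF hc).2 ⟨hPF d hd, fun p hp => ⟨fun hcp => ?_, ?_⟩⟩⟩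
  · exact (p.isMPrime.le_or_perp_le d).resolve_left (hcd p hp hcp)
  · exact (le_perp_comm.1 hdc).trans

end Topology

end MSpec

theorem HasContinuousRetraction.compactSpace {X : Type*} [TopologicalSpace X] [CompactSpace X]
    {S : Set X} (h : HasContinuousRetraction S) : CompactSpace S := by
  obtain ⟨r, hr, hrS⟩ := h
  have hsurj : Function.Surjective r := fun p => ⟨p, hrS p⟩
  exact ⟨hsurj.range_eq ▸ isCompact_range hr⟩

theorem HasContinuousRetraction.preimage {X Y : Type*} [TopologicalSpace X] [TopologicalSpace Y]
    (f : X ≃ₜ Y) {T : Set Y} (h : HasContinuousRetraction T) :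
    HasContinuousRetraction (f ⁻¹' T) := by
  obtain ⟨r, hr, hrT⟩ := h
  have hmem : ∀ x, f.symm (r (f x)) ∈ f ⁻¹' T := fun x => by
    rw [Set.mem_preimage, f.apply_symm_apply]
    exact (r (f x)).2
  refine ⟨fun x => ⟨f.symm (r (f x)), hmem x⟩, ?_, fun x => Subtype.ext ?_⟩
  · exact (f.symm.continuous.comp
      (continuous_subtype_val.comp (hr.comp f.continuous))).subtype_mk _
  · exact f.symm_apply_eq.2 (congrArg Subtype.val (hrT ⟨f x, x.2⟩))

theorem hasContinuousRetraction_preimage_iff {X Y : Type*} [TopologicalSpace X]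
    [TopologicalSpace Y] (f : X ≃ₜ Y) {T : Set Y} :
    HasContinuousRetraction (f ⁻¹' T) ↔ HasContinuousRetraction T := by
  refine ⟨fun h => ?_, HasContinuousRetraction.preimage f⟩
  simpa only [← Set.preimage_comp, f.self_comp_symm, Set.preimage_id] using h.preimage f.symm

/-! ### The spectrum of the frame of pure elements -/

section Vir

variable {A : Type*} [CommMonoid A] [CompleteLattice A] [IsCoherentQuantale A]

/-- `S ⊆ Spec(A)`, as a set of elements of `A`, is an open subset of `Spec_Z(Vir(A))`. -/
def IsOpenInVir (S : Set (MSpec A)) : Prop :=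
  ∃ U : Set (MSpec (Vir A)), IsOpen U ∧
    {a : A | ∃ q ∈ U, q.val.val = a} = {a : A | ∃ p ∈ S, p.val = a}

theorem Vir.val_top : (⊤ : Vir A).val = ⊤ := by
  rw [← IsIntegralQuantale.one_eq_top (A := A), ← IsIntegralQuantale.one_eq_top (A := Vir A)]
  rfl

theorem Vir.val_lt_top_iff {a : Vir A} : a.val < ⊤ ↔ a < ⊤ := by
  rw [lt_top_iff_ne_top, lt_top_iff_ne_top, ← Vir.val_top, Ne, Ne, Vir.ext_iff]

theorem IsMPrime.vir {p : A} (hp : IsMPrime p) (hpure : IsPure p) :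
    IsMPrime (⟨p, hpure⟩ : Vir A) :=
  ⟨Vir.val_lt_top_iff.1 hp.1, fun a b h => hp.2 a.val b.val h⟩

theorem IsPP.isPure_perp_perp (hPP : IsPP A) {c : A} (hc : IsCompactElement c) :
    IsPure (perp (perp c)) := by
  obtain ⟨e, he⟩ := hPP c hc
  exact perp_eq_of_isCompl he ▸ isPure_of_isCompl he.symm

theorem IsPP.isMPrime_val (hPP : IsPP A) (q : MSpec (Vir A)) : IsMPrime q.val.val := by
  refine isMPrime_of_forall_isCompactElement (Vir.val_lt_top_iff.2 q.isMPrime.1)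
    fun c d hc hd h => ?_
  have hcod : Codisjoint q.val.val (perp (c * d)) := codisjoint_iff.2
    (q.val.isPure _ (IsCoherentQuantale.isCompactElement_mul c d hc hd) h)
  have hle : perp (perp c) * perp (perp d) ≤ q.val.val := by
    refine le_of_codisjoint_of_mul_le hcod ?_
    rw [mul_comm, le_perp_iff.1 (perp_perp_mul_perp_perp_le c d)]
    exact bot_le
  exact (q.isMPrime.2 ⟨_, hPP.isPure_perp_perp hc⟩ ⟨_, hPP.isPure_perp_perp hd⟩ hle).imp
    (le_perp_perp c).trans (le_perp_perp d).trans

theorem IsPP.isOpenInVir_minimals_inter_D (hPP : IsPP A) {c : A} (hc : IsCompactElement c) :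
    IsOpenInVir (MSpec.minimals A ∩ MSpec.D c) := by
  obtain ⟨e, he⟩ := hPP c hc
  obtain ⟨hpure, hmin⟩ := (MSpec.isCompl_perp_iff hPP.isPF hc).1 he
  refine ⟨MSpec.D ⟨e, hpure⟩, MSpec.isOpen_D _, Set.ext fun a => ⟨?_, ?_⟩⟩
  · rintro ⟨q, hq, rfl⟩
    have hqmin : ⟨q.val.val, hPP.isMPrime_val q⟩ ∈ MSpec.minimals A :=
      MSpec.mem_minimals_of_isPure q.val.isPure
    exact ⟨_, ⟨hqmin, mt (hmin _ hqmin).1 hq⟩, rfl⟩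
  · rintro ⟨p, ⟨hpmin, hcp⟩, rfl⟩
    exact ⟨⟨_, p.isMPrime.vir ((MSpec.mem_minimals_iff_isPure hPP.isPF).1 hpmin)⟩,
      mt (hmin p hpmin).2 hcp, rfl⟩

theorem isPP_of_forall_isOpenInVir (hPF : IsPF A)
    (h : ∀ c : A, IsCompactElement c → IsOpenInVir (MSpec.minimals A ∩ MSpec.D c)) :
    IsPP A := by
  intro c hc
  obtain ⟨_, ⟨e, rfl⟩, heq⟩ := h c hc
  refine ⟨e.val, (MSpec.isCompl_perp_iff hPF hc).2 ⟨e.isPure, fun p hp => not_iff_not.1 ⟨?_, ?_⟩⟩⟩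
  · intro hcp
    obtain ⟨q, hq, hqp⟩ := heq.ge ⟨p, ⟨hp, hcp⟩, rfl⟩
    exact hqp ▸ hq
  · intro hep
    have hpure : IsPure p.val := (MSpec.mem_minimals_iff_isPure hPF).1 hp
    obtain ⟨q, ⟨-, hcq⟩, hqp⟩ := heq.le ⟨⟨_, p.isMPrime.vir hpure⟩, hep, rfl⟩
    exact (MSpec.ext hqp : q = p) ▸ hcq

end Vir

/-! ### Stone lattices and the reticulation -/

section Reticulation

variable {A : Type*} [CommMonoid A] [CompleteLattice A] [IsCoherentQuantale A]

namespace Reticulation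

theorem mk_eq_top_iff {c : CompactElt A} : mk c = ⊤ ↔ c.val = ⊤ := by
  refine ⟨fun h => ?_, fun h => top_le_iff.1 (PowLE.of_le h.ge)⟩
  obtain ⟨n, -, hn⟩ : PowLE (⊤ : A) c.val := top_le_iff.2 h
  rw [← IsIntegralQuantale.one_eq_top, one_pow, IsIntegralQuantale.one_eq_top] at hn
  exact top_le_iff.1 hn

theorem mk_inf_mk_eq_bot_iff (hA : IsSemiprime A) {c d : CompactElt A} :
    mk c ⊓ mk d = ⊥ ↔ c.val * d.val = ⊥ := by
  rw [← mk_mul, ← le_bot_iff]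
  exact ⟨hA.eq_bot_of_powLE_bot, fun h => PowLE.of_le h.le⟩

theorem isCompl_mk_iff (hA : IsSemiprime A) {c d : CompactElt A} :
    IsCompl (mk c) (mk d) ↔ IsCompl c.val d.val := by
  rw [isCompl_iff_codisjoint_and_mul_eq_bot, isCompl_iff, and_comm, disjoint_iff, codisjoint_iff,
    codisjoint_iff, mk_inf_mk_eq_bot_iff hA, ← mk_sup, mk_eq_top_iff]

theorem annihilator_eq_Iic_iff (hA : IsSemiprime A) {c f : CompactElt A}
    (hf : IsComplemented f.val) :
    {y | mk c ⊓ y = ⊥} = Set.Iic (mk f) ↔ perp c.val = f.val := by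
  obtain ⟨g, hg⟩ := hf
  have le_iff : ∀ d : CompactElt A, mk d ≤ mk f ↔ d.val ≤ f.val := fun d => by
    rw [mk_le_mk, ← perp_eq_of_isCompl hg.symm, hA.powLE_perp_iff]
  have mem_iff : ∀ d : CompactElt A, mk d ∈ {y | mk c ⊓ y = ⊥} ↔ d.val ≤ perp c.val := fun d => by
    rw [Set.mem_ofPred_eq, mk_inf_mk_eq_bot_iff hA, le_perp_iff]
  constructor
  · intro h
    refine eq_of_forall_isCompactElement_le_iff fun d hd => ?_
    rw [← mem_iff ⟨d, hd⟩, h, Set.mem_Iic, le_iff]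
  · intro h
    ext y
    obtain ⟨d, rfl⟩ := mk_surjective y
    rw [mem_iff, h, Set.mem_Iic, le_iff]

end Reticulation

theorem IsSemiprime.isPP_iff_isStoneLattice (hA : IsSemiprime A) :
    IsPP A ↔ IsStoneLattice (Reticulation A) := by
  constructor
  · intro hPP x
    obtain ⟨c, rfl⟩ := Reticulation.mk_surjective x
    obtain ⟨e, he⟩ := hPP c.val c.isCompact
    have htop := IsCoherentQuantale.isCompactElement_top (A := A)
    let f : CompactElt A := ⟨perp c.val, isCompactElement_of_isCompl htop he⟩
    let g : CompactElt A := ⟨e, isCompactElement_of_isCompl htop he.symm⟩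
    exact ⟨Reticulation.mk f, ⟨Reticulation.mk g, (Reticulation.isCompl_mk_iff hA).2 he⟩,
      (Reticulation.annihilator_eq_Iic_iff hA ⟨e, he⟩).2 rfl⟩
  · intro hL c hc
    obtain ⟨x, ⟨y, hxy⟩, hx⟩ := hL (Reticulation.mk ⟨c, hc⟩)
    obtain ⟨f, rfl⟩ := Reticulation.mk_surjective x
    obtain ⟨g, rfl⟩ := Reticulation.mk_surjective y
    have hf : IsComplemented f.val := ⟨g.val, (Reticulation.isCompl_mk_iff hA).1 hxy⟩
    exact ((Reticulation.annihilator_eq_Iic_iff hA hf).1 hx).symm ▸ hf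

/-! ### The spectrum of the reticulation -/

namespace Reticulation

/-- The ideal `a^*` of the reticulation: the classes of the compact elements with a positive power
below `a`, or equivalently (`c` and `c ^ n` have the same class) of those below `a`. -/
def toIdeal (a : A) : Order.Ideal (Reticulation A) where
  carrier := {x | ∃ c : CompactElt A, mk c = x ∧ PowLE c.val a}
  lower' := by
    rintro _ x hx ⟨c, rfl, hc⟩
    obtain ⟨d, rfl⟩ := mk_surjective x
    exact ⟨d, rfl, (mk_le_mk.1 hx).trans hc⟩
  nonempty' := ⟨_, ⟨⊥, isCompactElement_bot⟩, rfl, PowLE.of_le bot_le⟩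
  directed' := by
    rintro _ ⟨c, rfl, hc⟩ _ ⟨d, rfl, hd⟩
    exact ⟨_, ⟨_, mk_sup c d, hc.sup hd⟩, le_sup_left, le_sup_right⟩

theorem mk_mem_toIdeal {a : A} {c : CompactElt A} : mk c ∈ toIdeal a ↔ PowLE c.val a := by
  refine ⟨?_, fun h => ⟨c, rfl, h⟩⟩
  rintro ⟨d, hdc, hd⟩
  exact (mk_le_mk.1 hdc.ge).trans hd

theorem mk_mem_toIdeal_of_isMPrime {p : A} (hp : IsMPrime p) {c : CompactElt A} :
    mk c ∈ toIdeal p ↔ c.val ≤ p :=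
  mk_mem_toIdeal.trans ⟨hp.le_of_powLE, PowLE.of_le⟩

theorem isPrime_toIdeal {p : A} (hp : IsMPrime p) : (toIdeal p).IsPrime := by
  have : (toIdeal p).IsProper := Order.Ideal.isProper_of_notMem (p := ⊤) fun h =>
    hp.1.not_ge ((mk_mem_toIdeal_of_isMPrime hp
      (c := ⟨⊤, IsCoherentQuantale.isCompactElement_top⟩)).1 h)
  refine Order.Ideal.IsPrime.of_mem_or_mem fun {x y} h => ?_
  obtain ⟨c, rfl⟩ := mk_surjective x
  obtain ⟨d, rfl⟩ := mk_surjective y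
  rw [← mk_mul, mk_mem_toIdeal_of_isMPrime hp] at h
  rw [mk_mem_toIdeal_of_isMPrime hp, mk_mem_toIdeal_of_isMPrime hp]
  exact hp.2 _ _ h

/-- The element `I_*` of the quantale: the join of the compact elements whose class belongs to the
ideal `I` of the reticulation. -/
def ofIdeal (I : Order.Ideal (Reticulation A)) : A :=
  sSup {a | ∃ c : CompactElt A, c.val = a ∧ mk c ∈ I}

theorem le_ofIdeal_iff {I : Order.Ideal (Reticulation A)} {c : CompactElt A} :
    c.val ≤ ofIdeal I ↔ mk c ∈ I := by
  refine ⟨fun h => ?_, fun h => le_sSup ⟨c, rfl, h⟩⟩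
  have hne : {a | ∃ c : CompactElt A, c.val = a ∧ mk c ∈ I}.Nonempty :=
    ⟨⊥, ⟨⊥, isCompactElement_bot⟩, rfl, I.bot_mem⟩
  have hsup : SupClosed {a | ∃ c : CompactElt A, c.val = a ∧ mk c ∈ I} := by
    rintro _ ⟨a, rfl, ha⟩ _ ⟨b, rfl, hb⟩
    exact ⟨_, rfl, mk_sup a b ▸ Order.Ideal.sup_mem ha hb⟩
  obtain ⟨_, ⟨d, rfl, hd⟩, hcd⟩ := c.isCompact _ _ hne hsup.directedOn (isLUB_sSup _) h
  exact I.lower (mk_le_mk.2 (PowLE.of_le hcd)) hd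

theorem isMPrime_ofIdeal {I : Order.Ideal (Reticulation A)} (hI : I.IsPrime) :
    IsMPrime (ofIdeal I) := by
  refine isMPrime_of_forall_isCompactElement (lt_top_iff_ne_top.2 fun h => ?_)
    fun c d hc hd h => ?_
  · exact hI.toIsProper.top_notMem
      ((le_ofIdeal_iff (c := ⟨⊤, IsCoherentQuantale.isCompactElement_top⟩)).1 h.ge)
  · have hmem : mk ⟨c, hc⟩ ⊓ mk ⟨d, hd⟩ ∈ I := le_ofIdeal_iff.1 h
    exact (hI.mem_or_mem hmem).imp le_ofIdeal_iff.2 le_ofIdeal_iff.2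

end Reticulation

namespace MSpec

/-- The order isomorphism `p ↦ p^*`, `P ↦ P_*` between the `m`-prime elements of a coherent quantale
and the prime ideals of its reticulation. -/
def orderIsoIdSpec : MSpec A ≃o IdSpec (Reticulation A) where
  toFun p := ⟨Reticulation.toIdeal p.val, Reticulation.isPrime_toIdeal p.isMPrime⟩
  invFun P := ⟨Reticulation.ofIdeal P.val, Reticulation.isMPrime_ofIdeal P.isPrime⟩
  left_inv p := MSpec.ext <| eq_of_forall_isCompactElement_le_iff fun c hc =>
    (Reticulation.le_ofIdeal_iff (c := ⟨c, hc⟩)).trans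
      (Reticulation.mk_mem_toIdeal_of_isMPrime p.isMPrime)
  right_inv P := by
    refine IdSpec.ext (SetLike.ext fun x => ?_)
    obtain ⟨c, rfl⟩ := Reticulation.mk_surjective x
    exact (Reticulation.mk_mem_toIdeal_of_isMPrime (Reticulation.isMPrime_ofIdeal P.isPrime)).trans
      Reticulation.le_ofIdeal_iff
  map_rel_iff' {p q} := by
    refine ⟨fun h => le_iff_compact_le_imp.2 fun c hc hcp => ?_, ?_⟩
    · exact (Reticulation.mk_mem_toIdeal_of_isMPrime q.isMPrime).1
        (h ((Reticulation.mk_mem_toIdeal_of_isMPrime p.isMPrime (c := ⟨c, hc⟩)).2 hcp))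
    · rintro h _ ⟨c, rfl, hc⟩
      exact Reticulation.mk_mem_toIdeal.2 (hc.trans (PowLE.of_le h))

/-- The order isomorphism `orderIsoIdSpec` as a homeomorphism. -/
def homeomorphIdSpec : MSpec A ≃ₜ IdSpec (Reticulation A) where
  toEquiv := orderIsoIdSpec.toEquiv
  continuous_toFun := by
    refine continuous_generateFrom_iff.2 ?_
    rintro _ ⟨x, rfl⟩
    obtain ⟨c, rfl⟩ := Reticulation.mk_surjective x
    exact ⟨c.val, Set.ext fun p =>
      not_congr (Reticulation.mk_mem_toIdeal_of_isMPrime p.isMPrime)⟩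
  continuous_invFun := by
    refine isTopologicalBasis_D.continuous_iff.2 ?_
    rintro _ ⟨c, rfl⟩
    exact TopologicalSpace.isOpen_generateFrom_of_mem
      ⟨Reticulation.mk c, Set.ext fun P => not_congr Reticulation.le_ofIdeal_iff.symm⟩

theorem homeomorphIdSpec_preimage_minimals :
    homeomorphIdSpec ⁻¹' IdSpec.minimals (Reticulation A) = minimals A :=
  Set.ext fun _ => orderIsoIdSpec.isMin_apply

theorem hasContinuousRetraction_reticulation_iff :
    HasContinuousRetraction (IdSpec.minimals (Reticulation A)) ↔
      HasContinuousRetraction (minimals A) := by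
  rw [← homeomorphIdSpec_preimage_minimals, hasContinuousRetraction_preimage_iff]

end MSpec

end Reticulation

end PPQuantale

theorem theorem8p7 (A : Type*) [CommMonoid A] [CompleteLattice A] [IsCoherentQuantale A]
    (hPF : IsPF A) :
    List.TFAE
      [ IsPP A,
        IsStoneLattice (Reticulation A),
        HasContinuousRetraction (IdSpec.minimals (Reticulation A)),
        HasContinuousRetraction (MSpec.minimals A),
        ∀ c : A, IsCompactElement c →
          ∃ U : Set (MSpec (Vir A)), IsOpen U ∧
            {a : A | ∃ q ∈ U, q.val.val = a} =
              {a : A | ∃ p ∈ MSpec.minimals A ∩ MSpec.D c, p.val = a},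
        CompactSpace (MSpec.minimals A) ] := by
  tfae_have 1 ↔ 2 := hPF.isSemiprime.isPP_iff_isStoneLattice
  tfae_have 3 ↔ 4 := MSpec.hasContinuousRetraction_reticulation_iff
  tfae_have 1 → 4 := MSpec.hasContinuousRetraction_minimals
  tfae_have 4 → 6 := HasContinuousRetraction.compactSpace
  tfae_have 6 → 1 := fun _ => MSpec.isPP_of_compactSpace_minimals hPF
  tfae_have 1 → 5 := fun hPP _ hc => hPP.isOpenInVir_minimals_inter_D hc
  tfae_have 5 → 1 := isPP_of_forall_isOpenInVir hPF
  tfae_finish
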